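/- Let $k\ge 5$ be an integer and let $h_k\in\mathbb R[x,y]$ be a non-zero homogeneous polynomial of degree $k$ that is harmonic, i.e. $\Delta h_k=0$, where $\Delta=\frac{\partial^2}{\partial x^2}+\frac{\partial^2}{\partial y^2}$. For each $s\in\{1,\dots,k-4\}$ put $$\sigma_s=\begin{cases}s+1 & \text{if } s<\frac{k-3}{2},\\ s+2 & \text{if } s\ge\frac{k-3}{2},\end{cases}$$ and let $\rho_{k+s}\in\mathbb R[x,y]$ be a homogeneous polynomial of degree $k+s$ (possibly zero) with $\Delta^{\sigma_s}\rho_{k+s}=0$. Let $\mathcal E_2$ be the ring of germs at $\mathbf 0$ of real-valued $C^\infty$ functions on $\mathbb R^2$, let $\mathfrak m_2\subset\mathcal E_2$ be the ideal of the germs that vanish at $\mathbf 0$, and let $R\in\mathfrak m_2^{2k-3}$. Then the germs at $\mathbf 0$ of $h_k$ and of $h_k+\sum_{s=1}^{k-4}\rho_{k+s}+R$ are right equivalent: there is a germ of a $C^\infty$ diffeomorphism $\phi\colon(\mathbb R^2,\mathbf 0)\to(\mathbb R^2,\mathbf 0)$ such that $$h_k\circ\phi=h_k+\sum_{s=1}^{k-4}\rho_{k+s}+R$$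 as germs at $\mathbf 0$. -/

import Mathlib

open scoped Topology ContDiff

/-- A map `f` is smooth near the origin: it is `C^∞` at every point of some neighbourhood of `0`.
(This is stronger than `ContDiffAt ℝ ∞ f 0`, which gives for each finite order its own
neighbourhood.) -/
def SmoothNearZero {n : ℕ} {F : Type*} [NormedAddCommGroup F] [NormedSpace ℝ F]
    (f : EuclideanSpace ℝ (Fin n) → F) : Prop :=
  ∀ᶠ x in 𝓝 (0 : EuclideanSpace ℝ (Fin n)), ContDiffAt ℝ ∞ f x

/-- The ring `𝓔_n` of germs at `0` of `C^∞` functions on `ℝⁿ`, as a subring of the ring of germs at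
`0` of all real functions. -/
def SmoothGerm (n : ℕ) :
    Subring (Filter.Germ (𝓝 (0 : EuclideanSpace ℝ (Fin n))) ℝ) where
  carrier := {g | ∃ f : EuclideanSpace ℝ (Fin n) → ℝ, SmoothNearZero f ∧
    (f : Filter.Germ (𝓝 (0 : EuclideanSpace ℝ (Fin n))) ℝ) = g}
  zero_mem' := ⟨fun _ => 0, Filter.Eventually.of_forall fun _ => contDiffAt_const, rfl⟩
  one_mem' := ⟨fun _ => 1, Filter.Eventually.of_forall fun _ => contDiffAt_const, rfl⟩
  add_mem' := by
    rintro _ _ ⟨f, hf, rfl⟩ ⟨g, hg, rfl⟩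
    refine ⟨f + g, ?_, rfl⟩
    filter_upwards [hf, hg] with x hx hy using hx.add hy
  mul_mem' := by
    rintro _ _ ⟨f, hf, rfl⟩ ⟨g, hg, rfl⟩
    refine ⟨f * g, ?_, rfl⟩
    filter_upwards [hf, hg] with x hx hy using hx.mul hy
  neg_mem' := by
    rintro _ ⟨f, hf, rfl⟩
    refine ⟨-f, ?_, rfl⟩
    filter_upwards [hf] with x hx using hx.neg

/-- The ideal `𝔪_n` of `𝓔_n` of the smooth germs that vanish at `0`. -/
noncomputable def maxIdeal (n : ℕ) : Ideal (SmoothGerm n) :=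
  RingHom.ker
    ((Filter.Germ.valueRingHom (x := (0 : EuclideanSpace ℝ (Fin n))) (E := ℝ)).comp
      (SmoothGerm n).subtype)

/-- `φ` represents a germ of a `C^∞` diffeomorphism `(ℝⁿ, 0) → (ℝⁿ, 0)`. -/
def IsDiffeoGerm {n : ℕ} (φ : EuclideanSpace ℝ (Fin n) → EuclideanSpace ℝ (Fin n)) : Prop :=
  φ 0 = 0 ∧ SmoothNearZero φ ∧
    ∃ ψ : EuclideanSpace ℝ (Fin n) → EuclideanSpace ℝ (Fin n),
      ψ 0 = 0 ∧ SmoothNearZero ψ ∧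
      (∀ᶠ x in 𝓝 (0 : EuclideanSpace ℝ (Fin n)), ψ (φ x) = x) ∧
      (∀ᶠ x in 𝓝 (0 : EuclideanSpace ℝ (Fin n)), φ (ψ x) = x)

theorem IsDiffeoGerm.tendsto {n : ℕ}
    {φ : EuclideanSpace ℝ (Fin n) → EuclideanSpace ℝ (Fin n)} (hφ : IsDiffeoGerm φ) :
    Filter.Tendsto φ (𝓝 0) (𝓝 0) := by
  have h : ContinuousAt φ 0 := hφ.2.1.self_of_nhds.continuousAt
  simpa only [ContinuousAt, hφ.1] using h

/-- Right equivalence of smooth function germs: `h₁ ∘ φ = h₂` as germs at `0`, for some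
diffeomorphism germ `φ : (ℝⁿ, 0) → (ℝⁿ, 0)`. -/
def RightEquivalent {n : ℕ} (h₁ h₂ : SmoothGerm n) : Prop :=
  ∃ (φ : EuclideanSpace ℝ (Fin n) → EuclideanSpace ℝ (Fin n)) (hφ : IsDiffeoGerm φ),
    (h₁ : Filter.Germ (𝓝 (0 : EuclideanSpace ℝ (Fin n))) ℝ).compTendsto φ hφ.tendsto
      = (h₂ : Filter.Germ (𝓝 (0 : EuclideanSpace ℝ (Fin n))) ℝ)

/-- The Laplacian `Δ = ∂²/∂x² + ∂²/∂y²` on real polynomials in two variables. -/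
noncomputable def polyLaplacian (p : MvPolynomial (Fin 2) ℝ) : MvPolynomial (Fin 2) ℝ :=
  MvPolynomial.pderiv 0 (MvPolynomial.pderiv 0 p) +
    MvPolynomial.pderiv 1 (MvPolynomial.pderiv 1 p)

theorem smoothNearZero_eval (p : MvPolynomial (Fin 2) ℝ) :
    SmoothNearZero (fun x : EuclideanSpace ℝ (Fin 2) => MvPolynomial.eval (fun i => x i) p) := by
  refine Filter.Eventually.of_forall fun x => ContDiff.contDiffAt ?_
  induction p using MvPolynomial.induction_on with
  | C a => simpa using contDiff_const
  | add p q hp hq => simpa using hp.add hq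
  | mul_X p i hp =>
    simp only [map_mul, MvPolynomial.eval_X]
    exact hp.mul (by fun_prop)

/-- The germ at `0` of the function `ℝ² → ℝ` given by a polynomial. -/
noncomputable def polyGerm (p : MvPolynomial (Fin 2) ℝ) : SmoothGerm 2 :=
  ⟨((fun x : EuclideanSpace ℝ (Fin 2) => MvPolynomial.eval (fun i => x i) p :
      EuclideanSpace ℝ (Fin 2) → ℝ) : Filter.Germ (𝓝 (0 : EuclideanSpace ℝ (Fin 2))) ℝ),
    _, smoothNearZero_eval p, rfl⟩

/-- The exponent `σ_s`: it is `s + 1` if `s < (k - 3) / 2` (as real numbers), else `s + 2`. -/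
noncomputable def sigmaExp (k s : ℕ) : ℕ :=
  if (s : ℝ) < ((k : ℝ) - 3) / 2 then s + 1 else s + 2

/-!
In the complex coordinate `z = x₀ + i x₁` the Laplacian is `4 ∂² / ∂z ∂z̄`. Hence a harmonic form of
degree `k` is `Re (c z ^ k)`, and a form of degree `k + s` killed by `Δ ^ σ` involves only monomials
`z ^ a * z̄ ^ b` with `a < σ` or `b < σ`; the other exponent is then large, and since `z̄ ^ b` may be
conjugated inside a real part, the form is the real part of a multiple of `c z ^ k` or of
`c z ^ (k - 1)` (`exists_eval_eq_re_of_iterate_polyLaplacian_eq_zero`). By Hadamard's lemma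
(`SmoothNearZero.exists_eq_coord_mul_add`) the remainder has order `2k - 3` in `z, z̄`; every
monomial of that degree is divisible by `z ^ (k - 1)` or `z̄ ^ (k - 1)`, so the remainder is also
the real part of a multiple of `c z ^ (k - 1)`. The perturbed function is therefore
`Re (c z ^ k (1 + U) + c z ^ (k - 1) V)` with `U 0 = 0` and `V` of order at least `p = k / 2`.

Such a function is `Re (c (z u + X) ^ k)` for a suitable smooth `X` of order `p`, where
`u ^ k = 1 + U` (`exists_isDiffeoGerm_re_pow`). Indeed the linear term of the expansion in `X` is
`k c z ^ (k - 1) u ^ (k - 1) X`, and the higher terms have order at least `2k - 3`, so that up to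
real parts they are `c z ^ (k - 1) Y` with `Y` of order larger than `p`. Writing
`X = ∑ z ^ i z̄ ^ (p - i) y_i` and comparing coefficients turns `k u ^ (k - 1) X + Y = V` into a
finite system for the functions `y_i`, whose nonlinear part vanishes at `z = 0`; the implicit
function theorem solves it, with no need for the flow of a vector field. Since `p ≥ 2`, the map
`z u + X` has the identity as derivative at the origin and is a local diffeomorphism.
-/

/-! ### Powers of an ideal with two generators -/

section IdealAlgebra

variable {A : Type*} [CommRing A]

/-- If `2m ≤ n + 1`, every monomial of degree `n` in `a, b` is divisible by `a ^ m` or by `b ^ m`. -/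
theorem exists_pow_mul_add_pow_mul {a b : A} {m n : ℕ} (hmn : m + m ≤ n + 1) {F : A}
    (hF : F ∈ Ideal.span {a, b} ^ n) :
    ∃ G ∈ Ideal.span {a, b} ^ (n - m), ∃ H ∈ Ideal.span {a, b} ^ (n - m),
      F = a ^ m * G + b ^ m * H := by
  have key : Ideal.span {a, b} ^ n ≤ Ideal.span {a ^ m} * Ideal.span {a, b} ^ (n - m) ⊔
      Ideal.span {b ^ m} * Ideal.span {a, b} ^ (n - m) := by
    have ha : Ideal.span {a} ≤ Ideal.span {a, b} := Ideal.span_mono (by simp)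
    have hb : Ideal.span {b} ≤ Ideal.span {a, b} := Ideal.span_mono (by simp)
    have h0 : Ideal.span {a, b} = Ideal.span {a} + Ideal.span {b} := Ideal.span_insert _ _
    conv_lhs => rw [h0, add_pow]
    refine Finset.sum_induction _ (· ≤ _) (fun I J hI hJ => sup_le hI hJ) bot_le ?_
    intro i hi
    rw [Finset.mem_range] at hi
    refine Ideal.mul_le_left.trans ?_
    rcases le_or_gt m i with him | him
    · refine le_sup_of_le_left ?_
      obtain ⟨j, rfl⟩ := Nat.exists_eq_add_of_le him
      rw [pow_add, mul_assoc, ← Ideal.span_singleton_pow,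
        show n - m = j + (n - (m + j)) by omega, pow_add]
      exact Ideal.mul_mono_right (Ideal.mul_mono (Ideal.pow_right_mono ha _)
        (Ideal.pow_right_mono hb _))
    · refine le_sup_of_le_right ?_
      rw [show n - i = m + (n - i - m) by omega, pow_add, mul_left_comm,
        ← Ideal.span_singleton_pow, show n - m = i + (n - i - m) by omega, pow_add]
      exact Ideal.mul_mono_right (Ideal.mul_mono (Ideal.pow_right_mono ha _)
        (Ideal.pow_right_mono hb _))
  obtain ⟨F₁, h₁, F₂, h₂, rfl⟩ := Submodule.mem_sup.1 (key hF)
  obtain ⟨G, hG, rfl⟩ := Ideal.mem_span_singleton_mul.1 h₁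
  obtain ⟨H, hH, rfl⟩ := Ideal.mem_span_singleton_mul.1 h₂
  exact ⟨G, hG, H, hH, rfl⟩

theorem pow_mul_pow_mem_span_pair_pow (a b : A) {i j n : ℕ} (h : i + j = n) :
    a ^ i * b ^ j ∈ Ideal.span {a, b} ^ n := by
  rw [← h, pow_add]
  exact Ideal.mul_mem_mul (Ideal.pow_mem_pow (Ideal.subset_span (by simp)) _)
    (Ideal.pow_mem_pow (Ideal.subset_span (by simp)) _)

theorem span_pair_pow_le_span_range (a b : A) (p : ℕ) :
    Ideal.span {a, b} ^ p ≤
      Ideal.span (Set.range fun i : Fin (p + 1) => a ^ (i : ℕ) * b ^ (p - i)) := by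
  have h0 : Ideal.span {a, b} = Ideal.span {a} + Ideal.span {b} := Ideal.span_insert _ _
  rw [h0, add_pow]
  refine Finset.sum_induction _ (· ≤ _) (fun I J hI hJ => sup_le hI hJ) bot_le ?_
  intro i hi
  refine Ideal.mul_le_left.trans ?_
  rw [Ideal.span_singleton_pow, Ideal.span_singleton_pow, Ideal.span_singleton_mul_span_singleton,
    Ideal.span_singleton_le_iff_mem]
  exact Ideal.subset_span ⟨⟨i, Finset.mem_range.1 hi⟩, rfl⟩

theorem exists_sum_monomials_of_mem {a b : A} {J : Ideal A} {p : ℕ} {Y : A}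
    (hY : Y ∈ J * Ideal.span {a, b} ^ p) :
    ∃ y : Fin (p + 1) → A, (∀ i, y i ∈ J) ∧
      Y = ∑ i : Fin (p + 1), a ^ (i : ℕ) * b ^ (p - i) * y i := by
  have hY' := Ideal.mul_mono_right (span_pair_pow_le_span_range a b p) hY
  rw [← smul_eq_mul] at hY'
  obtain ⟨y, hy, rfl⟩ := (Submodule.mem_ideal_smul_span_iff_exists_sum _ _ _).1 hY'
  refine ⟨y, hy, ?_⟩
  rw [Finsupp.sum_fintype _ _ (by simp)]
  exact Finset.sum_congr rfl fun i _ => by rw [smul_eq_mul, mul_comm]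

/-- The part of `(α + β) ^ k` of degree at least two in `β` has high order if `β` does. -/
theorem add_pow_sub_linear_mem {M : Ideal A} {k p : ℕ} (hp : k ≤ 2 * p + 1) (hp1 : 1 ≤ p)
    (hk : 2 ≤ k) {α β : A} (hα : α ∈ M) (hβ : β ∈ M ^ p) :
    (α + β) ^ k - α ^ k - k * α ^ (k - 1) * β ∈ M ^ (2 * k - 3) := by
  obtain ⟨n, rfl⟩ := Nat.exists_eq_add_of_le' hk
  have : (α + β) ^ (n + 2) - α ^ (n + 2) - ((n + 2 : ℕ) : A) * α ^ (n + 2 - 1) * β =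
      ∑ j ∈ Finset.range (n + 1),
        β ^ (j + 1 + 1) * α ^ (n + 2 - (j + 1 + 1)) * ((n + 2).choose (j + 1 + 1) : A) := by
    rw [add_comm α β, add_pow, Finset.sum_range_succ', Finset.sum_range_succ']
    simp only [zero_add, pow_one, pow_zero, one_mul, Nat.choose_zero_right, Nat.choose_one_right,
      Nat.sub_zero, Nat.cast_one, mul_one]
    ring
  rw [this]
  refine Ideal.sum_mem _ fun j hj => Ideal.mul_mem_right _ _ ?_
  rw [Finset.mem_range] at hj
  have h1 : β ^ (j + 1 + 1) ∈ M ^ (p * (j + 1 + 1)) := by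
    rw [pow_mul]; exact Ideal.pow_mem_pow hβ _
  have h2 := Ideal.mul_mem_mul h1 (Ideal.pow_mem_pow hα (n + 2 - (j + 1 + 1)))
  rw [← pow_add] at h2
  refine Ideal.pow_le_pow_right ?_ h2
  obtain ⟨q, rfl⟩ := Nat.exists_eq_add_of_le' hp1
  have : (q + 1) * (j + 1 + 1) = q * j + 2 * q + j + 2 := by ring
  have : 0 ≤ q * j := Nat.zero_le _
  omega

end IdealAlgebra

/-! ### Rings of functions that are smooth near a point -/

/-- The ring of complex-valued functions on `W` that are `C^∞` on some neighbourhood of `w`. Actual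
functions are used rather than germs, so that they can be evaluated at points near `w`. -/
def smoothRing {W : Type*} [NormedAddCommGroup W] [NormedSpace ℝ W] (w : W) :
    Subring (W → ℂ) where
  carrier := {f | ∀ᶠ x in 𝓝 w, ContDiffAt ℝ ∞ f x}
  zero_mem' := Filter.Eventually.of_forall fun _ => contDiffAt_const
  one_mem' := Filter.Eventually.of_forall fun _ => contDiffAt_const
  add_mem' := by
    intro f g hf hg
    filter_upwards [hf, hg] with x hx hy using hx.add hy
  mul_mem' := by
    intro f g hf hg
    filter_upwards [hf, hg] with x hx hy using hx.mul hy
  neg_mem' := by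
    intro f hf
    filter_upwards [hf] with x hx using hx.neg

section SmoothRing

variable {W : Type*} [NormedAddCommGroup W] [NormedSpace ℝ W] {w : W}

theorem mem_smoothRing {f : W → ℂ} :
    f ∈ smoothRing w ↔ ∀ᶠ x in 𝓝 w, ContDiffAt ℝ ∞ f x := Iff.rfl

theorem ContDiff.mem_smoothRing {f : W → ℂ} (hf : ContDiff ℝ ∞ f) : f ∈ smoothRing w :=
  Filter.Eventually.of_forall fun _ => hf.contDiffAt

namespace smoothRing

/-- The constant function with value `c`. -/
def const (c : ℂ) : smoothRing w := ⟨fun _ => c, contDiff_const.mem_smoothRing⟩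

theorem coe_const (c : ℂ) : ((const c : smoothRing w) : W → ℂ) = fun _ => c := rfl

/-- Pointwise complex conjugation. -/
noncomputable def conj : smoothRing w →+* smoothRing w where
  toFun f := ⟨fun x => starRingEnd ℂ (f.1 x), by
    have hf : ∀ᶠ x in 𝓝 w, ContDiffAt ℝ ∞ f.1 x := f.2
    change ∀ᶠ x in 𝓝 w, _
    filter_upwards [hf] with x hx using Complex.conjCLE.contDiff.contDiffAt.comp x hx⟩
  map_zero' := by ext; simp
  map_one' := by ext; simp
  map_add' f g := by ext; simp
  map_mul' f g := by ext; simp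

theorem conj_apply (f : smoothRing w) (x : W) :
    (conj f).1 x = starRingEnd ℂ (f.1 x) := rfl

theorem conj_conj (f : smoothRing w) : conj (conj f) = f := by
  ext x; simp [conj_apply]

/-- The ideal generated by a function and its complex conjugate. -/
noncomputable def coordIdeal (a : smoothRing w) : Ideal (smoothRing w) := Ideal.span {a, conj a}

theorem self_mem_coordIdeal (a : smoothRing w) : a ∈ coordIdeal a :=
  Ideal.subset_span (by simp)

theorem conj_self_mem_coordIdeal (a : smoothRing w) : conj a ∈ coordIdeal a :=
  Ideal.subset_span (by simp)

theorem conj_mem_coordIdeal_pow {a f : smoothRing w} {n : ℕ} (hf : f ∈ coordIdeal a ^ n) :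
    conj f ∈ coordIdeal a ^ n := by
  have h := Ideal.mem_map_of_mem (conj (w := w)) hf
  rw [Ideal.map_pow] at h
  refine Ideal.pow_right_mono ?_ n h
  rw [coordIdeal, Ideal.map_span, Ideal.span_le]
  rintro _ ⟨x, hx, rfl⟩
  rcases hx with rfl | rfl
  · exact conj_self_mem_coordIdeal _
  · rw [conj_conj]; exact self_mem_coordIdeal _

theorem eq_zero_of_mem_coordIdeal {a f : smoothRing w} (hf : f ∈ coordIdeal a) {x : W}
    (hx : a.1 x = 0) : f.1 x = 0 := by
  obtain ⟨r, s, rfl⟩ := Ideal.mem_span_pair.1 hf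
  simp [conj_apply, hx]

/-- Up to its real part, `a ^ n * G + conj a ^ n * H` is a multiple of `c * a ^ n`, because
`conj a ^ n * H` has the same real part as `a ^ n * conj H`. -/
theorem exists_re_eq_re_mul_pow {a G H : smoothRing w} {n m : ℕ} {c : ℂ} (hc : c ≠ 0)
    (hG : G ∈ coordIdeal a ^ m) (hH : H ∈ coordIdeal a ^ m) :
    ∃ V ∈ coordIdeal a ^ m, ∀ x, ((a ^ n * G + conj a ^ n * H).1 x).re =
      (c * a.1 x ^ n * V.1 x).re := by
  refine ⟨const c⁻¹ * (G + conj H),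
    Ideal.mul_mem_left _ _ (add_mem hG (conj_mem_coordIdeal_pow hH)), fun x => ?_⟩
  have h1 : c * a.1 x ^ n * (const c⁻¹ * (G + conj H) : smoothRing w).1 x =
      a.1 x ^ n * G.1 x + a.1 x ^ n * starRingEnd ℂ (H.1 x) := by
    simp only [Subring.coe_mul, Subring.coe_add, Pi.mul_apply, Pi.add_apply, coe_const, conj_apply]
    field_simp
  have h2 : ((a ^ n * G + conj a ^ n * H).1 x) =
      a.1 x ^ n * G.1 x + starRingEnd ℂ (a.1 x ^ n * starRingEnd ℂ (H.1 x)) := by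
    simp [conj_apply]
  rw [h1, h2, Complex.add_re, Complex.add_re, Complex.conj_re]

/-- A function of order `n` in `a, conj a` has the real part of a multiple of `c * a ^ m`, provided
`2m ≤ n + 1`. -/
theorem exists_re_eq_of_mem_pow {a F : smoothRing w} {n m : ℕ} {c : ℂ} (hc : c ≠ 0)
    (hmn : m + m ≤ n + 1) (hF : F ∈ coordIdeal a ^ n) :
    ∃ V ∈ coordIdeal a ^ (n - m), ∀ x, (F.1 x).re = (c * a.1 x ^ m * V.1 x).re := by
  obtain ⟨G, hG, H, hH, rfl⟩ := exists_pow_mul_add_pow_mul hmn hF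
  exact exists_re_eq_re_mul_pow hc hG hH

end smoothRing

end SmoothRing

/-! ### Hadamard's lemma -/

universe u

theorem hasFDerivAt_integral_zero_one {E F : Type*} [NormedAddCommGroup E] [NormedSpace ℝ E]
    [ProperSpace E] [NormedAddCommGroup F] [NormedSpace ℝ F] {G : E × ℝ → F}
    (hG : ContDiff ℝ ∞ G) (x₀ : E) :
    HasFDerivAt (fun x => ∫ t in (0 : ℝ)..1, G (x, t))
      (∫ t in (0 : ℝ)..1, (fderiv ℝ G (x₀, t)).comp (ContinuousLinearMap.inl ℝ E ℝ)) x₀ := by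
  have hG' : Continuous fun q : E × ℝ =>
      (fderiv ℝ G q).comp (ContinuousLinearMap.inl ℝ E ℝ) :=
    (hG.continuous_fderiv (by simp)).clm_comp continuous_const
  have hK : IsCompact (Metric.closedBall x₀ 1 ×ˢ Set.Icc (0 : ℝ) 1) :=
    (isCompact_closedBall x₀ 1).prod isCompact_Icc
  obtain ⟨C, hC⟩ := hK.exists_bound_of_continuousOn hG'.continuousOn
  have hsec : ∀ x : E, Continuous fun t : ℝ => G (x, t) := fun x =>
    hG.continuous.comp (by fun_prop)
  refine intervalIntegral.hasFDerivAt_integral_of_dominated_of_fderiv_le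
    (F := fun x t => G (x, t))
    (F' := fun x t => (fderiv ℝ G (x, t)).comp (ContinuousLinearMap.inl ℝ E ℝ))
    (bound := fun _ => C) (Metric.closedBall_mem_nhds x₀ zero_lt_one)
    (Filter.Eventually.of_forall fun x => (hsec x).aestronglyMeasurable)
    ((hsec x₀).intervalIntegrable _ _)
    (hG'.comp (by fun_prop : Continuous fun t : ℝ => (x₀, t))).aestronglyMeasurable ?_
    intervalIntegrable_const ?_
  · refine Filter.Eventually.of_forall fun t ht x hx => hC (x, t) ⟨hx, ?_⟩
    rw [Set.uIoc_of_le zero_le_one] at ht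
    exact ⟨ht.1.le, ht.2⟩
  · refine Filter.Eventually.of_forall fun t _ x _ => ?_
    have h1 := (hG.differentiable (by simp) (x, t)).hasFDerivAt
    exact h1.comp x (hasFDerivAt_prodMk_left x t)

theorem contDiff_integral_zero_one {E : Type u} [NormedAddCommGroup E] [NormedSpace ℝ E]
    [ProperSpace E] (n : ℕ) : ∀ {F : Type u} [NormedAddCommGroup F] [NormedSpace ℝ F]
      {G : E × ℝ → F}, ContDiff ℝ ∞ G → ContDiff ℝ n (fun x => ∫ t in (0 : ℝ)..1, G (x, t)) := by
  induction n with
  | zero =>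
    intro F _ _ G hG
    rw [Nat.cast_zero, contDiff_zero]
    exact intervalIntegral.continuous_parametric_intervalIntegral_of_continuous'
      (f := fun x t => G (x, t)) hG.continuous 0 1
  | succ n ih =>
    intro F _ _ G hG
    rw [Nat.cast_succ, contDiff_succ_iff_hasFDerivAt]
    refine ⟨_, ih (G := fun q => (fderiv ℝ G q).comp (ContinuousLinearMap.inl ℝ E ℝ)) ?_,
      hasFDerivAt_integral_zero_one hG⟩
    exact (hG.fderiv_right (m := ∞) (by simp)).clm_comp contDiff_const

/-- Hadamard's lemma in two variables: a smooth function near the origin that vanishes at the origin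
is a combination of the two coordinates with smooth coefficients. -/
theorem SmoothNearZero.exists_eq_coord_mul_add {f : EuclideanSpace ℝ (Fin 2) → ℝ}
    (hf : SmoothNearZero f) (hf0 : f 0 = 0) :
    ∃ g₀ g₁ : EuclideanSpace ℝ (Fin 2) → ℝ, ContDiff ℝ ∞ g₀ ∧ ContDiff ℝ ∞ g₁ ∧
      ∀ᶠ x in 𝓝 (0 : EuclideanSpace ℝ (Fin 2)), f x = x 0 * g₀ x + x 1 * g₁ x := by
  -- A cut-off makes the function smooth everywhere, hence along the whole segment `[0, x]`.
  obtain ⟨ε, hε, hball⟩ := Metric.eventually_nhds_iff_ball.1 hf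
  let b : ContDiffBump (0 : EuclideanSpace ℝ (Fin 2)) := ⟨ε / 3, ε / 2, by positivity, by linarith⟩
  have hF : ContDiff ℝ ∞ fun x => b x * f x := by
    rw [contDiff_iff_contDiffAt]
    intro x
    by_cases hx : x ∈ Metric.ball (0 : EuclideanSpace ℝ (Fin 2)) ε
    · exact b.contDiff.contDiffAt.mul (hball x hx)
    · have : (fun x => b x * f x) =ᶠ[𝓝 x] fun _ => 0 := by
        have hx' : x ∈ (tsupport b)ᶜ := by
          rw [b.tsupport_eq]
          intro h
          rw [Metric.mem_closedBall] at h
          rw [Metric.mem_ball] at hx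
          exact hx (h.trans_lt (half_lt_self hε))
        filter_upwards [(isClosed_tsupport b).isOpen_compl.mem_nhds hx'] with y hy
        rw [image_eq_zero_of_notMem_tsupport hy, zero_mul]
      exact contDiffAt_const.congr_of_eventuallyEq this
  set F : EuclideanSpace ℝ (Fin 2) → ℝ := fun x => b x * f x with hFdef
  let g : Fin 2 → EuclideanSpace ℝ (Fin 2) → ℝ := fun i x =>
    ∫ t in (0 : ℝ)..1, fderiv ℝ F (t • x) (EuclideanSpace.single i 1)
  have hG : ∀ i, ContDiff ℝ ∞ fun q : EuclideanSpace ℝ (Fin 2) × ℝ =>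
      fderiv ℝ F (q.2 • q.1) (EuclideanSpace.single i 1) := fun i =>
    ((hF.fderiv_right (m := ∞) (by simp)).comp (contDiff_snd.smul contDiff_fst)).clm_apply
      contDiff_const
  have hg : ∀ i, ContDiff ℝ ∞ (g i) := fun i =>
    contDiff_infty.2 fun n => contDiff_integral_zero_one n (hG i)
  refine ⟨g 0, g 1, hg 0, hg 1, ?_⟩
  filter_upwards [b.eventuallyEq_one] with x hx
  have hF0 : F 0 = 0 := by simp [hFdef, hf0]
  have hFx : F x = f x := by simp [hFdef, hx]
  have hderiv : ∀ t : ℝ, HasDerivAt (fun t : ℝ => F (t • x)) (fderiv ℝ F (t • x) x) t := by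
    intro t
    have h1 := (hF.differentiable (by simp) (t • x)).hasFDerivAt
    have h2 : HasDerivAt (fun t : ℝ => t • x) x t := by
      simpa using (hasDerivAt_id t).smul_const x
    exact h1.comp_hasDerivAt t h2
  have hsec : ∀ i, Continuous fun t : ℝ =>
      fderiv ℝ F (t • x) (EuclideanSpace.single i 1) := fun i =>
    (hG i).continuous.comp (by fun_prop : Continuous fun t : ℝ => (x, t))
  have hx2 : x = x 0 • EuclideanSpace.single 0 1 + x 1 • EuclideanSpace.single 1 1 := by
    ext i; fin_cases i <;> simp
  have hsplit : ∀ t : ℝ, fderiv ℝ F (t • x) x =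
      x 0 * fderiv ℝ F (t • x) (EuclideanSpace.single 0 1) +
        x 1 * fderiv ℝ F (t • x) (EuclideanSpace.single 1 1) := by
    intro t
    conv_lhs => rw [hx2, map_add, map_smul, map_smul, ← hx2]
    simp
  have hint := intervalIntegral.integral_eq_sub_of_hasDerivAt (a := 0) (b := 1)
    (fun t _ => hderiv t) (by
      simp_rw [hsplit]
      exact (((hsec 0).const_mul _).add ((hsec 1).const_mul _)).intervalIntegrable _ _)
  simp only [one_smul, zero_smul, hF0, sub_zero, hFx] at hint
  rw [← hint]
  simp_rw [hsplit]
  rw [intervalIntegral.integral_add (((hsec 0).const_mul _).intervalIntegrable _ _)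
    (((hsec 1).const_mul _).intervalIntegrable _ _), intervalIntegral.integral_const_mul,
    intervalIntegral.integral_const_mul]

/-! ### Inverse and implicit functions that are smooth on a neighbourhood -/

/-- The inverse function theorem for functions that are `C^∞` on a neighbourhood of a point; the
local inverse is then `C^∞` on a neighbourhood as well. -/
theorem exists_smooth_local_inverse {E F : Type*} [NormedAddCommGroup E] [NormedSpace ℝ E]
    [CompleteSpace E] [NormedAddCommGroup F] [NormedSpace ℝ F] {f : E → F} {a : E}
    (hf : ∀ᶠ x in 𝓝 a, ContDiffAt ℝ ∞ f x) (f' : E ≃L[ℝ] F)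
    (hf' : HasFDerivAt f (f' : E →L[ℝ] F) a) :
    ∃ g : F → E, g (f a) = a ∧ (∀ᶠ y in 𝓝 (f a), ContDiffAt ℝ ∞ g y) ∧
      (∀ᶠ x in 𝓝 a, g (f x) = x) ∧ ∀ᶠ y in 𝓝 (f a), f (g y) = y := by
  have hfa : ContDiffAt ℝ ∞ f a := hf.self_of_nhds
  let e := hfa.toOpenPartialHomeomorph f hf' (by simp)
  have hae : a ∈ e.source := hfa.mem_toOpenPartialHomeomorph_source hf' (by simp)
  have hfae : f a ∈ e.target := hfa.image_mem_toOpenPartialHomeomorph_target hf' (by simp)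
  have hsymm : e.symm (f a) = a := e.left_inv hae
  have hequiv : ∀ᶠ x in 𝓝 a,
      fderiv ℝ f x ∈ Set.range ((↑) : (E ≃L[ℝ] F) → E →L[ℝ] F) := by
    have hc : ContinuousAt (fderiv ℝ f) a :=
      (hfa.fderiv_right (m := ∞) (by simp)).continuousAt
    refine hc.eventually_mem ?_
    rw [hf'.fderiv]
    exact f'.nhds
  have hcont : Filter.Tendsto e.symm (𝓝 (f a)) (𝓝 a) := by
    have := e.continuousAt_symm hfae
    rwa [ContinuousAt, hsymm] at this
  refine ⟨e.symm, hsymm, ?_, e.eventually_left_inverse hae, e.eventually_right_inverse hfae⟩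
  filter_upwards [hcont.eventually hf, hcont.eventually hequiv, e.open_target.mem_nhds hfae]
    with y hy ⟨L, hL⟩ hyt
  refine e.contDiffAt_symm hyt (f₀' := L) ?_ hy
  rw [hL]
  exact (hy.differentiableAt (by simp)).hasFDerivAt

/-- An implicit function theorem, for an equation that is affine in the unknown `y` over the base
point. -/
theorem exists_smooth_implicit {E Y : Type*} [NormedAddCommGroup E] [NormedSpace ℝ E]
    [FiniteDimensional ℝ E] [NormedAddCommGroup Y] [NormedSpace ℝ Y] [FiniteDimensional ℝ Y]
    {G : E × Y → Y} {y₀ : Y} (hG : ∀ᶠ q in 𝓝 ((0 : E), y₀), ContDiffAt ℝ ∞ G q) {c : ℝ}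
    (hc : c ≠ 0) (h0 : ∀ y, G (0, y) = c • (y - y₀)) :
    ∃ ψ : E → Y, ψ 0 = y₀ ∧ (∀ᶠ x in 𝓝 (0 : E), ContDiffAt ℝ ∞ ψ x) ∧
      ∀ᶠ x in 𝓝 (0 : E), G (x, ψ x) = 0 := by
  have : CompleteSpace E := FiniteDimensional.complete ℝ E
  have : CompleteSpace Y := FiniteDimensional.complete ℝ Y
  let Φ : E × Y → E × Y := fun q => (q.1, G q)
  have hΦ : ∀ᶠ q in 𝓝 ((0 : E), y₀), ContDiffAt ℝ ∞ Φ q := by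
    filter_upwards [hG] with q hq using contDiffAt_fst.prodMk hq
  have hG' := (hG.self_of_nhds.differentiableAt (by simp)).hasFDerivAt
  set G' := fderiv ℝ G ((0 : E), y₀)
  have hG'0 : ∀ y, G' (0, y) = c • y := by
    intro y
    have h1 : HasFDerivAt (fun y => G (0, y)) (G'.comp (ContinuousLinearMap.inr ℝ E Y)) y₀ :=
      hG'.comp y₀ (hasFDerivAt_prodMk_right (0 : E) y₀)
    have h2 : HasFDerivAt (fun y => G (0, y)) (c • ContinuousLinearMap.id ℝ Y) y₀ := by
      simp_rw [h0]
      exact ((hasFDerivAt_id y₀).sub_const y₀).const_smul c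
    simpa using DFunLike.congr_fun (h1.unique h2) y
  let L : E × Y →L[ℝ] E × Y := (ContinuousLinearMap.fst ℝ E Y).prod G'
  have hL : Function.Injective (L : E × Y →ₗ[ℝ] E × Y) := by
    rw [injective_iff_map_eq_zero]
    rintro ⟨x, y⟩ hxy
    have h1 : x = 0 := congrArg Prod.fst hxy
    have h2 : G' (x, y) = 0 := congrArg Prod.snd hxy
    subst h1
    rw [hG'0, smul_eq_zero] at h2
    rw [h2.resolve_left hc]; rfl
  let L' : (E × Y) ≃L[ℝ] (E × Y) :=
    (LinearEquiv.ofInjectiveEndo (L : E × Y →ₗ[ℝ] E × Y) hL).toContinuousLinearEquiv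
  have hL' : (L' : E × Y →L[ℝ] E × Y) = L := by ext q <;> rfl
  obtain ⟨g, hg0, hgs, -, hgr⟩ := exists_smooth_local_inverse hΦ L'
    (by rw [hL']; exact hasFDerivAt_fst.prodMk hG')
  have hΦ0 : Φ (0, y₀) = (0, 0) := by simp [Φ, h0]
  rw [hΦ0] at hg0 hgs hgr
  have hι : Filter.Tendsto (fun x : E => (x, (0 : Y))) (𝓝 0) (𝓝 (0, 0)) :=
    (by fun_prop : Continuous fun x : E => (x, (0 : Y))).tendsto 0
  refine ⟨fun x => (g (x, 0)).2, by simp only [hg0], ?_, ?_⟩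
  · filter_upwards [hι.eventually hgs] with x hx
    exact contDiffAt_snd.comp x (hx.comp x (contDiffAt_id.prodMk contDiffAt_const))
  · filter_upwards [hι.eventually hgr] with x hx
    have h1 : (g (x, 0)).1 = x := congrArg Prod.fst hx
    have h2 : G (g (x, 0)) = 0 := congrArg Prod.snd hx
    rwa [show (x, (g (x, 0)).2) = g (x, 0) from Prod.ext h1.symm rfl]

/-! ### Harmonic and polyharmonic polynomials in complex coordinates -/

/-- The identification of the Euclidean plane with `ℂ`, that is, the function `z = x₀ + i x₁`. -/
noncomputable def complexCoord : EuclideanSpace ℝ (Fin 2) ≃L[ℝ] ℂ :=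
  Complex.orthonormalBasisOneI.repr.symm.toContinuousLinearEquiv

theorem complexCoord_apply (x : EuclideanSpace ℝ (Fin 2)) :
    complexCoord x = x 0 + x 1 * Complex.I := by
  simp [complexCoord]

/-- The function `z` as an element of the ring of functions smooth near the origin. -/
noncomputable def zFun : smoothRing (0 : EuclideanSpace ℝ (Fin 2)) :=
  ⟨complexCoord, complexCoord.contDiff.mem_smoothRing⟩

theorem zFun_apply (x : EuclideanSpace ℝ (Fin 2)) : zFun.1 x = complexCoord x := rfl

namespace MvPolynomial

/-- Rewriting a real polynomial in the coordinates `z` (variable `0`) and `z̄` (variable `1`). -/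
noncomputable def toComplexCoords : MvPolynomial (Fin 2) ℝ →ₐ[ℝ] MvPolynomial (Fin 2) ℂ :=
  aeval ![C (1 / 2) * (X 0 + X 1), C (-Complex.I / 2) * (X 0 - X 1)]

theorem toComplexCoords_X_zero :
    toComplexCoords (X 0) = C (1 / 2) * (X 0 + X 1) := by simp [toComplexCoords]

theorem toComplexCoords_X_one :
    toComplexCoords (X 1) = C (-Complex.I / 2) * (X 0 - X 1) := by simp [toComplexCoords]

theorem eval_toComplexCoords (p : MvPolynomial (Fin 2) ℝ) (x : EuclideanSpace ℝ (Fin 2)) :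
    eval ![complexCoord x, starRingEnd ℂ (complexCoord x)] (toComplexCoords p) =
      (eval (fun i => x i) p : ℝ) := by
  induction p using MvPolynomial.induction_on with
  | C a =>
    rw [← algebraMap_eq, AlgHom.commutes, algebraMap_eq, eval_C,
      IsScalarTower.algebraMap_apply ℝ ℂ (MvPolynomial (Fin 2) ℂ), algebraMap_eq, eval_C]
    rfl
  | add p q hp hq => simp [hp, hq]
  | mul_X p i hp =>
    rw [map_mul, map_mul, hp, map_mul, eval_X, Complex.ofReal_mul]
    congr 1
    fin_cases i
    · change eval _ (toComplexCoords (X 0)) = _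
      rw [toComplexCoords_X_zero]
      simp [complexCoord_apply]
      ring
    · change eval _ (toComplexCoords (X 1)) = _
      rw [toComplexCoords_X_one]
      simp [complexCoord_apply]
      linear_combination -(x 1 : ℂ) * Complex.I_sq

theorem IsHomogeneous.toComplexCoords {p : MvPolynomial (Fin 2) ℝ} {n : ℕ}
    (hp : p.IsHomogeneous n) : (toComplexCoords p).IsHomogeneous n := by
  rw [← one_mul n]
  refine hp.aeval _ fun i => ?_
  fin_cases i
  · exact ((isHomogeneous_X _ _).add (isHomogeneous_X _ _)).C_mul _
  · exact ((isHomogeneous_X _ _).sub (isHomogeneous_X _ _)).C_mul _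

theorem pderiv_toComplexCoords (j : Fin 2) (p : MvPolynomial (Fin 2) ℝ) :
    pderiv j (toComplexCoords p) = toComplexCoords (pderiv 0 p) * pderiv j (toComplexCoords (X 0)) +
      toComplexCoords (pderiv 1 p) * pderiv j (toComplexCoords (X 1)) := by
  induction p using MvPolynomial.induction_on with
  | C a =>
    rw [← algebraMap_eq, AlgHom.commutes, algebraMap_eq,
      IsScalarTower.algebraMap_apply ℝ ℂ (MvPolynomial (Fin 2) ℂ), algebraMap_eq]
    simp
  | add p q hp hq => simp only [map_add, hp, hq]; ring
  | mul_X p i hp =>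
    rw [map_mul, pderiv_mul, hp]
    fin_cases i <;>
    · simp only [pderiv_mul, map_mul, map_add, Fin.zero_eta, Fin.mk_one, pderiv_X_self, Fin.isValue,
        pderiv_X_of_ne one_ne_zero, pderiv_X_of_ne zero_ne_one, map_one, map_zero]
      ring

theorem pderiv_comm {R σ : Type*} [CommSemiring R] (i j : σ) (p : MvPolynomial σ R) :
    pderiv i (pderiv j p) = pderiv j (pderiv i p) := by
  classical
  ext m
  simp only [coeff_pderiv, Finsupp.add_apply, add_right_comm m, Finsupp.single_apply]
  by_cases h : i = j
  · subst h; rfl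
  · simp only [h, Ne.symm h, if_false, add_zero]
    ring

/-- In the coordinates `z, z̄` the Laplacian is `4 ∂² / ∂z ∂z̄`. -/
theorem pderiv_pderiv_toComplexCoords (p : MvPolynomial (Fin 2) ℝ) :
    pderiv 0 (pderiv 1 (toComplexCoords p)) = C (1 / 4) * toComplexCoords (polyLaplacian p) := by
  have h00 : pderiv (0 : Fin 2) (toComplexCoords (X 0)) = C (1 / 2) := by
    rw [toComplexCoords_X_zero, pderiv_C_mul, map_add, pderiv_X_self, pderiv_X_of_ne one_ne_zero,
      add_zero, mul_one]
  have h01 : pderiv (0 : Fin 2) (toComplexCoords (X 1)) = C (-Complex.I / 2) := by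
    rw [toComplexCoords_X_one, pderiv_C_mul, map_sub, pderiv_X_self, pderiv_X_of_ne one_ne_zero,
      sub_zero, mul_one]
  have h10 : pderiv (1 : Fin 2) (toComplexCoords (X 0)) = C (1 / 2) := by
    rw [toComplexCoords_X_zero, pderiv_C_mul, map_add, pderiv_X_self, pderiv_X_of_ne zero_ne_one,
      zero_add, mul_one]
  have h11 : pderiv (1 : Fin 2) (toComplexCoords (X 1)) = -C (-Complex.I / 2) := by
    rw [toComplexCoords_X_one, pderiv_C_mul, map_sub, pderiv_X_self, pderiv_X_of_ne zero_ne_one,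
      zero_sub, mul_neg, mul_one]
  have h4 : (C (1 / 2) * C (1 / 2) : MvPolynomial (Fin 2) ℂ) = C (1 / 4) := by
    rw [← C_mul]; norm_num
  have hI : (C (-Complex.I / 2) * C (-Complex.I / 2) : MvPolynomial (Fin 2) ℂ) = -C (1 / 4) := by
    rw [← C_mul, ← C_neg]; congr 1; linear_combination Complex.I_sq / 4
  rw [pderiv_toComplexCoords 1 p, h10, h11, map_add, pderiv_mul, pderiv_mul, map_neg, pderiv_C,
    pderiv_C, pderiv_toComplexCoords 0 (pderiv 0 p), pderiv_toComplexCoords 0 (pderiv 1 p), h00, h01,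
    polyLaplacian, map_add, pderiv_comm 1 0 p]
  linear_combination toComplexCoords (pderiv 0 (pderiv 0 p)) * h4 -
    toComplexCoords (pderiv 1 (pderiv 1 p)) * hI

theorem iterate_pderiv_pderiv_toComplexCoords (n : ℕ) (p : MvPolynomial (Fin 2) ℝ) :
    (fun q => pderiv 0 (pderiv 1 q))^[n] (toComplexCoords p) =
      C ((1 / 4) ^ n) * toComplexCoords (polyLaplacian^[n] p) := by
  induction n generalizing p with
  | zero => simp
  | succ n ih =>
    have hC : ∀ (a : ℂ) (q : MvPolynomial (Fin 2) ℂ),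
        (fun q => pderiv 0 (pderiv 1 q))^[n] (C a * q) =
          C a * (fun q => pderiv 0 (pderiv 1 q))^[n] q := by
      intro a q
      refine Function.Semiconj.iterate_right (f := fun q => C a * q) (fun q => ?_) n q |>.symm
      simp only [pderiv_C_mul]
    rw [Function.iterate_succ_apply, pderiv_pderiv_toComplexCoords, hC, ih,
      Function.iterate_succ_apply, ← mul_assoc, ← C_mul, pow_succ']

theorem coeff_eq_zero_of_iterate_pderiv_eq_zero {n : ℕ} {q : MvPolynomial (Fin 2) ℂ}
    (hq : (fun q => pderiv 0 (pderiv 1 q))^[n] q = 0) {m : Fin 2 →₀ ℕ} (h0 : n ≤ m 0)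
    (h1 : n ≤ m 1) : coeff m q = 0 := by
  induction n generalizing q m with
  | zero => simp only [Function.iterate_zero, id] at hq; simp [hq]
  | succ n ih =>
    obtain ⟨m', rfl⟩ : ∃ m', m = m' + Finsupp.single 0 1 + Finsupp.single 1 1 := by
      refine ⟨m - Finsupp.single 0 1 - Finsupp.single 1 1, ?_⟩
      ext i; fin_cases i <;> simp <;> omega
    simp only [Finsupp.add_apply] at h0 h1
    have h := ih (m := m') hq (by simpa using h0) (by simpa using h1)
    simp only [coeff_pderiv] at h
    have h3 : ∀ a : ℕ, (a : ℂ) + 1 ≠ 0 := fun a => by exact_mod_cast a.succ_ne_zero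
    exact (mul_eq_zero.1 ((mul_eq_zero.1 h).resolve_right (h3 _))).resolve_right (h3 _)

end MvPolynomial

open MvPolynomial in
/-- A homogeneous polynomial of degree `d` in the kernel of `Δ ^ σ` only involves monomials
`z ^ a * z̄ ^ b` with `a < σ` or `b < σ`, hence with `b ≥ n` or `a ≥ n` when `n + σ ≤ d + 1`. -/
theorem exists_eval_eq_re_of_iterate_polyLaplacian_eq_zero {p : MvPolynomial (Fin 2) ℝ}
    {d n σ : ℕ} (hd : p.IsHomogeneous d) (hσ : polyLaplacian^[σ] p = 0) (hn : n + σ ≤ d + 1)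
    {c : ℂ} (hc : c ≠ 0) :
    ∃ V ∈ smoothRing.coordIdeal zFun ^ (d - n), ∀ x : EuclideanSpace ℝ (Fin 2),
      eval (fun i => x i) p = (c * complexCoord x ^ n * V.1 x).re := by
  set q := toComplexCoords p with hq
  have hqhom : q.IsHomogeneous d := hd.toComplexCoords
  have hqker : (fun q => pderiv 0 (pderiv 1 q))^[σ] q = 0 := by
    rw [hq, iterate_pderiv_pderiv_toComplexCoords, hσ, map_zero, mul_zero]
  let F : smoothRing (0 : EuclideanSpace ℝ (Fin 2)) := ∑ m ∈ q.support,
    smoothRing.const (coeff m q) * (zFun ^ m 0 * smoothRing.conj zFun ^ m 1)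
  have hF : ∀ x, F.1 x = (eval (fun i => x i) p : ℝ) := by
    intro x
    rw [← eval_toComplexCoords, eval_eq']
    simp [F, Finset.sum_apply, smoothRing.coe_const, smoothRing.conj_apply, zFun_apply, hq]
  have hFmem : F ∈ Ideal.span {zFun ^ n} * smoothRing.coordIdeal zFun ^ (d - n) ⊔
      Ideal.span {smoothRing.conj zFun ^ n} * smoothRing.coordIdeal zFun ^ (d - n) := by
    refine Ideal.sum_mem _ fun m hm => Ideal.mul_mem_left _ _ ?_
    have hm' : coeff m q ≠ 0 := mem_support_iff.1 hm
    have hdeg : m 0 + m 1 = d := by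
      have := hqhom hm'
      rw [Finsupp.weight_apply, Finsupp.sum_fintype _ _ (by simp)] at this
      simpa using this
    have hmon : ∀ i j, i + j = d - n → zFun ^ i * smoothRing.conj zFun ^ j ∈
        smoothRing.coordIdeal zFun ^ (d - n) := fun i j => pow_mul_pow_mem_span_pair_pow _ _
    have hlt : m 0 < σ ∨ m 1 < σ := by
      by_contra! h
      exact hm' (coeff_eq_zero_of_iterate_pderiv_eq_zero hqker h.1 h.2)
    rcases hlt with h | h
    · refine Ideal.mem_sup_right ?_
      obtain ⟨j, hj⟩ := Nat.exists_eq_add_of_le (show n ≤ m 1 by omega)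
      rw [hj, pow_add, mul_left_comm]
      exact Ideal.mul_mem_mul (Ideal.mem_span_singleton_self _) (hmon _ _ (by omega))
    · refine Ideal.mem_sup_left ?_
      obtain ⟨j, hj⟩ := Nat.exists_eq_add_of_le (show n ≤ m 0 by omega)
      rw [hj, pow_add, mul_assoc]
      exact Ideal.mul_mem_mul (Ideal.mem_span_singleton_self _) (hmon _ _ (by omega))
  obtain ⟨F₁, h₁, F₂, h₂, hF₁₂⟩ := Submodule.mem_sup.1 hFmem
  obtain ⟨G, hG, rfl⟩ := Ideal.mem_span_singleton_mul.1 h₁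
  obtain ⟨H, hH, rfl⟩ := Ideal.mem_span_singleton_mul.1 h₂
  obtain ⟨V, hV, hVx⟩ := smoothRing.exists_re_eq_re_mul_pow (n := n) hc hG hH
  refine ⟨V, hV, fun x => ?_⟩
  rw [← zFun_apply, ← hVx, hF₁₂, hF, Complex.ofReal_re]

open MvPolynomial in
/-- A non-zero harmonic homogeneous polynomial of degree `k ≥ 1` is `Re (c z ^ k)` with `c ≠ 0`. -/
theorem exists_eval_eq_re_mul_pow_of_polyLaplacian_eq_zero {p : MvPolynomial (Fin 2) ℝ} {k : ℕ}
    (hk : 1 ≤ k) (hp : p ≠ 0) (hhom : p.IsHomogeneous k) (hharm : polyLaplacian p = 0) :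
    ∃ c : ℂ, c ≠ 0 ∧ ∀ x : EuclideanSpace ℝ (Fin 2),
      eval (fun i => x i) p = (c * complexCoord x ^ k).re := by
  set q := toComplexCoords p with hq
  have hqhom : q.IsHomogeneous k := hhom.toComplexCoords
  have hqker : (fun q => pderiv 0 (pderiv 1 q))^[1] q = 0 := by
    rw [hq, iterate_pderiv_pderiv_toComplexCoords, Function.iterate_one, hharm, map_zero, mul_zero]
  let m₀ : Fin 2 →₀ ℕ := Finsupp.single 0 k
  let m₁ : Fin 2 →₀ ℕ := Finsupp.single 1 k
  have hne : m₀ ≠ m₁ := by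
    intro h
    have := DFunLike.congr_fun h 0
    simp [m₀, m₁] at this
    omega
  have hsupp : q.support ⊆ {m₀, m₁} := by
    intro m hm
    have hm' : coeff m q ≠ 0 := mem_support_iff.1 hm
    have hdeg : m 0 + m 1 = k := by
      have := hqhom hm'
      rw [Finsupp.weight_apply, Finsupp.sum_fintype _ _ (by simp)] at this
      simpa using this
    have hlt : m 0 < 1 ∨ m 1 < 1 := by
      by_contra! h
      exact hm' (coeff_eq_zero_of_iterate_pderiv_eq_zero hqker h.1 h.2)
    rw [Finset.mem_insert, Finset.mem_singleton]
    rcases hlt with h | h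
    · right; ext i; fin_cases i <;> simp [m₁] <;> omega
    · left; ext i; fin_cases i <;> simp [m₀] <;> omega
  have heval : ∀ x : EuclideanSpace ℝ (Fin 2), eval (fun i => x i) p =
      ((coeff m₀ q + starRingEnd ℂ (coeff m₁ q)) * complexCoord x ^ k).re := by
    intro x
    have h1 : ((eval (fun i => x i) p : ℝ) : ℂ) = coeff m₀ q * complexCoord x ^ k +
        coeff m₁ q * starRingEnd ℂ (complexCoord x) ^ k := by
      rw [← eval_toComplexCoords, eval_eq', Finset.sum_subset hsupp
        (fun m _ hm => by rw [notMem_support_iff.1 hm, zero_mul]), Finset.sum_pair hne]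
      simp [m₀, m₁, hq]
    rw [← Complex.ofReal_re (eval _ p), h1, add_mul, Complex.add_re, Complex.add_re,
      ← Complex.conj_re (starRingEnd ℂ _ * _)]
    simp
  refine ⟨_, ?_, heval⟩
  intro hc
  refine hp (MvPolynomial.funext fun v => ?_)
  have := heval (WithLp.toLp 2 v)
  rw [hc, zero_mul, Complex.zero_re] at this
  rw [map_zero]
  exact this

/-! ### Solving for the change of coordinates -/

theorem smoothRing.hasFDerivAt_zero_of_mem_sq {W : Type*} [NormedAddCommGroup W] [NormedSpace ℝ W]
    {w : W} {a f : smoothRing w} (hf : f ∈ coordIdeal a ^ 2) (ha : a.1 w = 0) :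
    HasFDerivAt f.1 (0 : W →L[ℝ] ℂ) w := by
  rw [pow_two] at hf
  have hd : ∀ g : smoothRing w, HasFDerivAt g.1 (fderiv ℝ g.1 w) w := fun g =>
    ((mem_smoothRing.1 g.2).self_of_nhds.differentiableAt (by simp)).hasFDerivAt
  refine Submodule.mul_induction_on hf (fun g hg h hh => ?_) fun g h hg hh => ?_
  · refine ((hd g).mul (hd h)).congr_fderiv ?_
    ext x
    simp [eq_zero_of_mem_coordIdeal hg ha, eq_zero_of_mem_coordIdeal hh ha]
  · simpa using! hg.add hh

theorem smoothRing.exists_pow_eq_one_add {W : Type*} [NormedAddCommGroup W] [NormedSpace ℝ W]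
    {w : W} {k : ℕ} (hk : k ≠ 0) {U : smoothRing w} (hU : U.1 w = 0) :
    ∃ u : smoothRing w, u ^ k = 1 + U ∧ u.1 w = 1 := by
  have hUs : ∀ᶠ x in 𝓝 w, ContDiffAt ℝ ∞ U.1 x := U.2
  have hslit : ∀ᶠ x in 𝓝 w, 1 + U.1 x ∈ Complex.slitPlane := by
    have hcont : ContinuousAt (fun x => 1 + U.1 x) w :=
      continuousAt_const.add hUs.self_of_nhds.continuousAt
    exact hcont.eventually_mem (Complex.isOpen_slitPlane.mem_nhds (by simp [hU]))
  refine ⟨⟨fun x => (1 + U.1 x) ^ ((k : ℂ)⁻¹), ?_⟩, ?_, by simp [hU]⟩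
  · rw [mem_smoothRing]
    filter_upwards [hUs, hslit] with x hx hxs
    have h1 : AnalyticAt ℂ (fun w : ℂ => w ^ ((k : ℂ)⁻¹)) (1 + U.1 x) :=
      analyticAt_id.cpow analyticAt_const hxs
    exact (h1.contDiffAt.restrict_scalars ℝ).comp x (contDiffAt_const.add hx)
  · ext x
    exact Complex.cpow_nat_inv_pow _ hk

/-- If `U 0 = 0` and `V` has order at least `k / 2` (rounded down), then `Re (c z ^ k)` is right
equivalent to `Re (c z ^ k (1 + U) + c z ^ (k - 1) V)`. The change of coordinates has the form
`z u + X`, where `u` is the `k`-th root of `1 + U` and the coefficients of `X` solve an implicit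
equation. -/
theorem exists_isDiffeoGerm_re_pow {k : ℕ} (hk : 5 ≤ k) {c : ℂ} (hc : c ≠ 0)
    {U V : smoothRing (0 : EuclideanSpace ℝ (Fin 2))} (hU : U.1 0 = 0)
    (hV : V ∈ smoothRing.coordIdeal zFun ^ (k / 2)) :
    ∃ φ : EuclideanSpace ℝ (Fin 2) → EuclideanSpace ℝ (Fin 2), IsDiffeoGerm φ ∧
      ∀ᶠ x in 𝓝 (0 : EuclideanSpace ℝ (Fin 2)), (c * complexCoord (φ x) ^ k).re =
        (c * complexCoord x ^ k * (1 + U.1 x)).re + (c * complexCoord x ^ (k - 1) * V.1 x).re := by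
  have hk0 : k ≠ 0 := by omega
  set p := k / 2 with hp
  obtain ⟨v, -, hv⟩ := exists_sum_monomials_of_mem (J := ⊤)
    (show V ∈ _ * Ideal.span {zFun, smoothRing.conj zFun} ^ p by rwa [Ideal.top_mul])
  obtain ⟨⟨u, hus⟩, huU, hu0⟩ := smoothRing.exists_pow_eq_one_add hk0 hU
  rw [mem_smoothRing] at hus
  have huk : ∀ x, u x ^ k = 1 + U.1 x := fun x => congrFun (congrArg Subtype.val huU) x
  replace hu0 : u 0 = 1 := hu0
  -- The coefficients of the monomials `z ^ i * z̄ ^ (p - i)` in `X` are treated as extra variables.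
  set y₀ : Fin (p + 1) → ℂ := fun i => (k : ℝ)⁻¹ • (v i).1 0 with hy₀
  let w : EuclideanSpace ℝ (Fin 2) × (Fin (p + 1) → ℂ) := (0, y₀)
  have hfst : Filter.Tendsto Prod.fst (𝓝 w) (𝓝 0) := continuous_fst.tendsto w
  let ζ : smoothRing w := ⟨fun q => complexCoord q.1,
    (complexCoord.contDiff.comp contDiff_fst).mem_smoothRing⟩
  let u' : smoothRing w := ⟨fun q => u q.1, by
    rw [mem_smoothRing]
    filter_upwards [hfst.eventually hus] with q hq using hq.comp q contDiffAt_fst⟩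
  let Yc : Fin (p + 1) → smoothRing w := fun i =>
    ⟨fun q => q.2 i, ContDiff.mem_smoothRing (by fun_prop)⟩
  let X : smoothRing w := ∑ i : Fin (p + 1), ζ ^ (i : ℕ) * smoothRing.conj ζ ^ (p - i) * Yc i
  have hXmem : X ∈ smoothRing.coordIdeal ζ ^ p := by
    exact Ideal.sum_mem _ fun i _ => Ideal.mul_mem_right _ _
      (pow_mul_pow_mem_span_pair_pow _ _ (Nat.add_sub_of_le (Nat.lt_succ_iff.1 i.2)))
  have hX : ∀ q, X.1 q = ∑ i : Fin (p + 1),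
      complexCoord q.1 ^ (i : ℕ) * starRingEnd ℂ (complexCoord q.1) ^ (p - i) * q.2 i := by
    intro q
    simp [X, ζ, Yc, Finset.sum_apply, smoothRing.conj_apply]
  -- The terms of degree at least two in `X` of the `k`-th power of `z u + X` have order at least
  -- `2k - 3` because `k ≤ 2p + 1`, so up to real parts they are `c z ^ (k - 1) Y`. As `k ≥ 5`, the
  -- order `k - 2` of `Y` exceeds `p`, which makes the coefficients of `Y` vanish over the origin.
  have herr := add_pow_sub_linear_mem (k := k) (p := p) (by omega) (by omega) (by omega)
    (Ideal.mul_mem_right u' _ (smoothRing.self_mem_coordIdeal ζ)) hXmem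
  obtain ⟨Y, hYmem, hY⟩ := smoothRing.exists_re_eq_of_mem_pow (m := k - 1)
    (F := smoothRing.const c * _) hc (by omega) (Ideal.mul_mem_left _ (smoothRing.const c) herr)
  have hYmem' : Y ∈ smoothRing.coordIdeal ζ * smoothRing.coordIdeal ζ ^ p := by
    rw [← pow_succ']
    exact Ideal.pow_le_pow_right (by omega) hYmem
  obtain ⟨y, hymem, hy⟩ := exists_sum_monomials_of_mem hYmem'
  -- The implicit equation for the coefficients.
  let G : EuclideanSpace ℝ (Fin 2) × (Fin (p + 1) → ℂ) → (Fin (p + 1) → ℂ) := fun q i =>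
    k * u q.1 ^ (k - 1) * q.2 i + (y i).1 q - (v i).1 q.1
  have hGs : ∀ᶠ q in 𝓝 w, ContDiffAt ℝ ∞ G q := by
    have h1 : ∀ᶠ q in 𝓝 w, ∀ i, ContDiffAt ℝ ∞ (y i).1 q :=
      Filter.eventually_all.2 fun i => (y i).2
    have h2 : ∀ᶠ q in 𝓝 w, ∀ i, ContDiffAt ℝ ∞ (v i).1 q.1 :=
      hfst.eventually (Filter.eventually_all.2 fun i => (v i).2)
    filter_upwards [h1, h2, hfst.eventually hus] with q hq1 hq2 hq3
    refine contDiffAt_pi.2 fun i => ?_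
    exact (((contDiffAt_const.mul ((hq3.comp q contDiffAt_fst).pow _)).mul
      ((contDiff_apply ℝ ℂ i).contDiffAt.comp q contDiffAt_snd)).add (hq1 i)).sub
      ((hq2 i).comp q contDiffAt_fst)
  have hkR : (k : ℝ) ≠ 0 := Nat.cast_ne_zero.2 hk0
  have hG0 : ∀ b, G (0, b) = (k : ℝ) • (b - y₀) := by
    intro b
    ext i
    have h1 : (y i).1 (0, b) = 0 :=
      smoothRing.eq_zero_of_mem_coordIdeal (hymem i) (by simp [ζ])
    have hkC : (k : ℂ) ≠ 0 := Nat.cast_ne_zero.2 hk0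
    simp only [G, hu0, h1, hy₀, one_pow, Pi.smul_apply, Pi.sub_apply, Complex.real_smul]
    push_cast
    field_simp
    ring
  obtain ⟨ψ, hψ0, hψs, hψ⟩ := exists_smooth_implicit hGs hkR hG0
  -- The change of coordinates, first as a complex-valued function.
  let f : EuclideanSpace ℝ (Fin 2) → ℂ := fun x => complexCoord x * u x + X.1 (x, ψ x)
  have hfs : ∀ᶠ x in 𝓝 (0 : EuclideanSpace ℝ (Fin 2)), ContDiffAt ℝ ∞ f x := by
    filter_upwards [hus, hψs] with x hx1 hx2
    have hXs : ContDiff ℝ ∞ X.1 := by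
      rw [show X.1 = _ from funext hX]
      have h1 : ContDiff ℝ ∞ fun q : EuclideanSpace ℝ (Fin 2) × (Fin (p + 1) → ℂ) =>
        complexCoord q.1 := complexCoord.contDiff.comp contDiff_fst
      refine ContDiff.sum fun i _ => ((h1.pow _).mul
        ((Complex.conjCLE.contDiff.comp h1).pow _)).mul (by fun_prop)
    exact (complexCoord.contDiff.contDiffAt.mul hx1).add
      (hXs.contDiffAt.comp x (contDiffAt_id.prodMk hx2))
  have hf0 : f 0 = 0 := by
    have : X.1 (0, ψ 0) = 0 := by
      refine smoothRing.eq_zero_of_mem_coordIdeal (Ideal.pow_le_self (by omega) hXmem) (by simp [ζ])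
    simp [f, this]
  have hz0 : HasFDerivAt (fun x : EuclideanSpace ℝ (Fin 2) => complexCoord x)
      (complexCoord : EuclideanSpace ℝ (Fin 2) →L[ℝ] ℂ) 0 := complexCoord.hasFDerivAt
  have hf' : HasFDerivAt f (complexCoord : EuclideanSpace ℝ (Fin 2) →L[ℝ] ℂ) 0 := by
    have h1 : HasFDerivAt (fun x => complexCoord x * u x)
        (complexCoord : EuclideanSpace ℝ (Fin 2) →L[ℝ] ℂ) 0 := by
      have := hz0.mul (hus.self_of_nhds.differentiableAt (by simp)).hasFDerivAt
      refine this.congr_fderiv ?_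
      ext x
      simp [hu0]
    have h2 : HasFDerivAt (fun x => X.1 (x, ψ x))
        (0 : EuclideanSpace ℝ (Fin 2) →L[ℝ] ℂ) 0 := by
      have h3 : HasFDerivAt X.1 (0 : EuclideanSpace ℝ (Fin 2) × (Fin (p + 1) → ℂ) →L[ℝ] ℂ)
          (0, ψ 0) := by
        rw [hψ0]
        exact smoothRing.hasFDerivAt_zero_of_mem_sq (Ideal.pow_le_pow_right (by omega) hXmem)
          (show ζ.1 w = 0 by simp [ζ, w])
      have h4 : HasFDerivAt (fun x => (x, ψ x)) _ 0 := (hasFDerivAt_id 0).prodMk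
        (hψs.self_of_nhds.differentiableAt (by simp)).hasFDerivAt
      exact (h3.comp 0 h4).congr_fderiv (by simp)
    simpa using! h1.add h2
  let φ : EuclideanSpace ℝ (Fin 2) → EuclideanSpace ℝ (Fin 2) := fun x => complexCoord.symm (f x)
  have hφs : ∀ᶠ x in 𝓝 (0 : EuclideanSpace ℝ (Fin 2)), ContDiffAt ℝ ∞ φ x := by
    filter_upwards [hfs] with x hx using complexCoord.symm.contDiff.contDiffAt.comp x hx
  have hφ0 : φ 0 = 0 := by simp [φ, hf0]
  have hφ' : HasFDerivAt φ
      (ContinuousLinearEquiv.refl ℝ (EuclideanSpace ℝ (Fin 2)) :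
        EuclideanSpace ℝ (Fin 2) →L[ℝ] EuclideanSpace ℝ (Fin 2)) 0 := by
    have := (complexCoord.symm.hasFDerivAt (x := f 0)).comp 0 hf'
    refine this.congr_fderiv ?_
    ext x; simp
  obtain ⟨g, hg0, hgs, hgl, hgr⟩ := exists_smooth_local_inverse hφs _ hφ'
  rw [hφ0] at hg0 hgs hgr
  refine ⟨φ, ⟨hφ0, hφs, g, hg0, hgs, hgl, hgr⟩, ?_⟩
  filter_upwards [hψ] with x hx
  have hφx : complexCoord (φ x) = f x := complexCoord.apply_symm_apply _
  have hlin : k * u x ^ (k - 1) * X.1 (x, ψ x) + Y.1 (x, ψ x) = V.1 x := by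
    have hYx : Y.1 (x, ψ x) = ∑ i : Fin (p + 1), complexCoord x ^ (i : ℕ) *
        starRingEnd ℂ (complexCoord x) ^ (p - i) * (y i).1 (x, ψ x) := by
      rw [hy]; simp [ζ, Finset.sum_apply, smoothRing.conj_apply]
    have hVx : V.1 x = ∑ i : Fin (p + 1), complexCoord x ^ (i : ℕ) *
        starRingEnd ℂ (complexCoord x) ^ (p - i) * (v i).1 x := by
      rw [hv]; simp [zFun_apply, Finset.sum_apply, smoothRing.conj_apply]
    rw [hYx, hVx, hX, Finset.mul_sum, ← Finset.sum_add_distrib]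
    refine Finset.sum_congr rfl fun i _ => ?_
    have hi : k * u x ^ (k - 1) * ψ x i + (y i).1 (x, ψ x) - (v i).1 x = 0 := congrFun hx i
    linear_combination (complexCoord x ^ (i : ℕ) *
        starRingEnd ℂ (complexCoord x) ^ (p - i)) * hi
  have hYre := hY (x, ψ x)
  have hE : (smoothRing.const c * ((ζ * u' + X) ^ k - (ζ * u') ^ k -
      (k : smoothRing w) * (ζ * u') ^ (k - 1) * X) :
      smoothRing w).1 (x, ψ x) = c * (f x ^ k - (complexCoord x * u x) ^ k -
        k * (complexCoord x * u x) ^ (k - 1) * X.1 (x, ψ x)) := by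
    simp [smoothRing.coe_const, f, ζ, u']
  rw [hE] at hYre
  have hsplit : c * f x ^ k = c * complexCoord x ^ k * (1 + U.1 x) +
      c * complexCoord x ^ (k - 1) * (k * u x ^ (k - 1) * X.1 (x, ψ x)) +
      c * (f x ^ k - (complexCoord x * u x) ^ k -
        k * (complexCoord x * u x) ^ (k - 1) * X.1 (x, ψ x)) := by
    rw [← huk]; ring
  rw [hφx, hsplit, Complex.add_re, Complex.add_re, hYre, ← hlin,
    mul_add (c * complexCoord x ^ (k - 1)), Complex.add_re, add_assoc]

/-! ### Powers of the maximal ideal of smooth germs -/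

/-- By Hadamard's lemma, a germ in the `N`-th power of the maximal ideal has order `N` in the
coordinates `z, z̄`. -/
theorem exists_mem_coordIdeal_pow_of_mem_maxIdeal_pow (N : ℕ) {R : SmoothGerm 2}
    (hR : R ∈ maxIdeal 2 ^ N) :
    ∃ F ∈ smoothRing.coordIdeal zFun ^ N, ∃ r : EuclideanSpace ℝ (Fin 2) → ℝ,
      (r : Filter.Germ (𝓝 (0 : EuclideanSpace ℝ (Fin 2))) ℝ) = R.1 ∧
        ∀ᶠ x in 𝓝 (0 : EuclideanSpace ℝ (Fin 2)), F.1 x = r x := by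
  have hlift : ∀ {g : EuclideanSpace ℝ (Fin 2) → ℝ}, SmoothNearZero g →
      (fun x => (g x : ℂ)) ∈ smoothRing (0 : EuclideanSpace ℝ (Fin 2)) := by
    intro g hg
    rw [mem_smoothRing]
    filter_upwards [hg] with x hx using Complex.ofRealCLM.contDiff.contDiffAt.comp x hx
  induction N generalizing R with
  | zero =>
    obtain ⟨r, hr, hrR⟩ := R.2
    exact ⟨⟨_, hlift hr⟩, by simp, r, hrR, Filter.Eventually.of_forall fun _ => rfl⟩
  | succ N ih =>
    rw [pow_succ'] at hR ⊢
    refine Submodule.mul_induction_on hR (fun Q hQ T hT => ?_) fun Q T hQ hT => ?_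
    · obtain ⟨F, hF, t, ht, hFt⟩ := ih hT
      obtain ⟨q, hq, hqQ⟩ := Q.2
      have hq0 : q 0 = 0 := by
        have h1 : Filter.Germ.value Q.1 = 0 := hQ
        rwa [← hqQ] at h1
      obtain ⟨g₀, g₁, hg₀, hg₁, hg⟩ := hq.exists_eq_coord_mul_add hq0
      let G₀ : smoothRing (0 : EuclideanSpace ℝ (Fin 2)) :=
        ⟨_, hlift (Filter.Eventually.of_forall fun x => hg₀.contDiffAt)⟩
      let G₁ : smoothRing (0 : EuclideanSpace ℝ (Fin 2)) :=
        ⟨_, hlift (Filter.Eventually.of_forall fun x => hg₁.contDiffAt)⟩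
      -- The coordinates are `x₀ = (z + z̄) / 2` and `x₁ = -i (z - z̄) / 2`.
      refine ⟨(smoothRing.const (1 / 2) * (zFun + smoothRing.conj zFun) * G₀ +
        smoothRing.const (-Complex.I / 2) * (zFun - smoothRing.conj zFun) * G₁) * F,
        Ideal.mul_mem_mul (add_mem ?_ ?_) hF, q * t, ?_, ?_⟩
      · exact Ideal.mul_mem_right _ _ (Ideal.mul_mem_left _ _
          (add_mem (smoothRing.self_mem_coordIdeal _) (smoothRing.conj_self_mem_coordIdeal _)))
      · exact Ideal.mul_mem_right _ _ (Ideal.mul_mem_left _ _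
          (sub_mem (smoothRing.self_mem_coordIdeal _) (smoothRing.conj_self_mem_coordIdeal _)))
      · rw [Filter.Germ.coe_mul, hqQ, ht]; rfl
      · filter_upwards [hFt, hg] with x hx1 hx2
        simp only [Subring.coe_mul, Subring.coe_add, AddSubgroupClass.coe_sub, Pi.mul_apply,
          Pi.add_apply, Pi.sub_apply, smoothRing.coe_const, smoothRing.conj_apply, zFun_apply,
          complexCoord_apply, hx1, hx2, G₀, G₁, map_add, map_mul, Complex.conj_ofReal,
          Complex.conj_I]
        push_cast
        linear_combination -(x 1 : ℂ) * g₁ x * t x * Complex.I_sq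
    · obtain ⟨F, hF, q, hq, hFq⟩ := hQ
      obtain ⟨H, hH, t, ht, hHt⟩ := hT
      refine ⟨F + H, add_mem hF hH, q + t, ?_, ?_⟩
      · rw [Filter.Germ.coe_add, hq, ht]; rfl
      · filter_upwards [hFq, hHt] with x hx1 hx2
        simp [hx1, hx2]

/-! ### The normal form of the perturbation -/

/-- The perturbation `ρ` of degree `k + s` is the real part of a multiple of `c z ^ k` for small
`s`, and of a multiple of `c z ^ (k - 1)` of order at least `k / 2` for large `s`. -/
theorem exists_eval_eq_re_add_re {k s : ℕ} (hk : 5 ≤ k) (hs : s ∈ Finset.Icc 1 (k - 4))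
    {ρ : MvPolynomial (Fin 2) ℝ} (hρ : ρ.IsHomogeneous (k + s))
    (hker : polyLaplacian^[sigmaExp k s] ρ = 0) {c : ℂ} (hc : c ≠ 0) :
    ∃ U V : smoothRing (0 : EuclideanSpace ℝ (Fin 2)), U.1 0 = 0 ∧
      V ∈ smoothRing.coordIdeal zFun ^ (k / 2) ∧ ∀ x : EuclideanSpace ℝ (Fin 2),
        MvPolynomial.eval (fun i => x i) ρ = (c * complexCoord x ^ k * U.1 x).re +
          (c * complexCoord x ^ (k - 1) * V.1 x).re := by
  rw [Finset.mem_Icc] at hs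
  rw [sigmaExp] at hker
  split_ifs at hker with h
  -- Here `σ_s = s + 1`, so one of the exponents of `z, z̄` in each monomial is at least `k`.
  · obtain ⟨U, hU, hUx⟩ := exists_eval_eq_re_of_iterate_polyLaplacian_eq_zero (n := k) hρ hker
      (by omega) hc
    refine ⟨U, 0, ?_, zero_mem _, fun x => by simp [hUx]⟩
    exact smoothRing.eq_zero_of_mem_coordIdeal (Ideal.pow_le_self (by omega) hU)
      (by simp [zFun_apply])
  -- Here `σ_s = s + 2`, so one of the exponents is only known to be at least `k - 1`.
  · obtain ⟨V, hV, hVx⟩ := exists_eval_eq_re_of_iterate_polyLaplacian_eq_zero (n := k - 1) hρ hker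
      (by omega) hc
    refine ⟨0, V, rfl, Ideal.pow_le_pow_right ?_ hV, fun x => by simp [hVx]⟩
    have h1 : (k : ℝ) ≤ 2 * s + 3 := by linarith
    have h2 : k ≤ 2 * s + 3 := by exact_mod_cast h1
    omega

theorem theorem3p1 (k : ℕ) (hk : 5 ≤ k)
    (h : MvPolynomial (Fin 2) ℝ) (h_ne : h ≠ 0)
    (h_hom : h.IsHomogeneous k) (h_harm : polyLaplacian h = 0)
    (ρ : ℕ → MvPolynomial (Fin 2) ℝ)
    (ρ_hom : ∀ s ∈ Finset.Icc 1 (k - 4), (ρ s).IsHomogeneous (k + s))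
    (ρ_ker : ∀ s ∈ Finset.Icc 1 (k - 4), polyLaplacian^[sigmaExp k s] (ρ s) = 0)
    (R : SmoothGerm 2) (hR : R ∈ maxIdeal 2 ^ (2 * k - 3)) :
    RightEquivalent (polyGerm h)
      (polyGerm h + ∑ s ∈ Finset.Icc 1 (k - 4), polyGerm (ρ s) + R) := by
  obtain ⟨c, hc, hh⟩ :=
    exists_eval_eq_re_mul_pow_of_polyLaplacian_eq_zero (by omega) h_ne h_hom h_harm
  have hρ : ∀ s, ∃ U V : smoothRing (0 : EuclideanSpace ℝ (Fin 2)), s ∈ Finset.Icc 1 (k - 4) →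
      U.1 0 = 0 ∧ V ∈ smoothRing.coordIdeal zFun ^ (k / 2) ∧ ∀ x : EuclideanSpace ℝ (Fin 2),
        MvPolynomial.eval (fun i => x i) (ρ s) = (c * complexCoord x ^ k * U.1 x).re +
          (c * complexCoord x ^ (k - 1) * V.1 x).re := by
    intro s
    by_cases hs : s ∈ Finset.Icc 1 (k - 4)
    · obtain ⟨U, V, hUV⟩ := exists_eval_eq_re_add_re hk hs (ρ_hom s hs) (ρ_ker s hs) hc
      exact ⟨U, V, fun _ => hUV⟩
    · exact ⟨0, 0, fun hs' => absurd hs' hs⟩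
  choose U V hUV using hρ
  obtain ⟨F, hF, r, hrR, hFr⟩ := exists_mem_coordIdeal_pow_of_mem_maxIdeal_pow _ hR
  obtain ⟨W, hW, hWx⟩ := smoothRing.exists_re_eq_of_mem_pow (m := k - 1) hc (by omega) hF
  obtain ⟨φ, hφ, hφx⟩ := exists_isDiffeoGerm_re_pow hk hc
    (U := ∑ s ∈ Finset.Icc 1 (k - 4), U s) (V := ∑ s ∈ Finset.Icc 1 (k - 4), V s + W)
    (by
      rw [AddSubmonoidClass.coe_finsetSum, Finset.sum_apply]
      exact Finset.sum_eq_zero fun s hs => (hUV s hs).1)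
    (add_mem (Ideal.sum_mem _ fun s hs => (hUV s hs).2.1) (Ideal.pow_le_pow_right (by omega) hW))
  refine ⟨φ, hφ, ?_⟩
  have hsum : ((∑ s ∈ Finset.Icc 1 (k - 4), polyGerm (ρ s) : SmoothGerm 2) :
      Filter.Germ (𝓝 (0 : EuclideanSpace ℝ (Fin 2))) ℝ) =
      ((∑ s ∈ Finset.Icc 1 (k - 4), fun x : EuclideanSpace ℝ (Fin 2) =>
        MvPolynomial.eval (fun i => x i) (ρ s) : EuclideanSpace ℝ (Fin 2) → ℝ) :
          Filter.Germ (𝓝 (0 : EuclideanSpace ℝ (Fin 2))) ℝ) := by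
    rw [AddSubmonoidClass.coe_finsetSum]
    exact (map_sum (Filter.Germ.coeRingHom (R := ℝ) (𝓝 (0 : EuclideanSpace ℝ (Fin 2)))) _ _).symm
  rw [Subring.coe_add, Subring.coe_add, hsum, ← hrR]
  refine Filter.Germ.coe_eq.2 ?_
  filter_upwards [hφx, hFr] with x hx1 hx2
  have hrx : r x = (c * complexCoord x ^ (k - 1) * W.1 x).re := by
    rw [← zFun_apply, ← hWx, hx2, Complex.ofReal_re]
  simp only [Function.comp_apply, Finset.sum_apply]
  rw [hh, hx1, hh, hrx, Finset.sum_congr rfl fun s hs => (hUV s hs).2.2 x,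
    Finset.sum_add_distrib, ← Complex.re_sum, ← Complex.re_sum, ← Finset.mul_sum, ← Finset.mul_sum,
    Subring.coe_add, AddSubmonoidClass.coe_finsetSum, AddSubmonoidClass.coe_finsetSum,
    Pi.add_apply, Finset.sum_apply, Finset.sum_apply, mul_add, mul_add, mul_one, Complex.add_re,
    Complex.add_re]
  ring
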